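/- Let $s>5/2$ and let $u\in H^s(\mathbb{R}^3;\mathbb{R}^3)$ be divergence free (in the sense of distributions) and permutation symmetric, that is, $P\,u(P^{tr}x)=u(x)$ for almost every $x\in\mathbb{R}^3$, for each of the six $3\times 3$ permutation matrices $P$. Then $u$ has a (unique) continuously differentiable representative, which we still denote by $u$. Write $(\nabla u)_{ij}=\partial_i u_j$, $\omega=\nabla\times u$ and $\sigma=(1,1,1)$. Then there is a real number $\lambda$ such that $$\nabla u(0)=\lambda\begin{pmatrix}0&-1&-1\\-1&0&-1\\-1&-1&0\end{pmatrix},$$ and $$\lambda=\frac{3}{8\pi}\int_{\mathbb{R}^3}\frac{(\sigma\cdot x)(x_2-x_3)}{|x|^5}\,\omega_1(x)\,dx =\frac{3}{8\pi}\int_{\mathbb{R}^3}\frac{(\sigma\cdot x)(x_3-x_1)}{|x|^5}\,\omega_2(x)\,dx =\frac{3}{8\pi}\int_{\mathbb{R}^3}\frac{(\sigma\cdot x)(x_1-x_2)}{|x|^5}\,\omega_3(x)\,dx,$$ where all three integrals converge absolutely. -/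

import Mathlib

noncomputable section

namespace PermSymm

open MeasureTheory
open scoped SchwartzMap ContDiff

/-- Three-dimensional Euclidean space. -/
abbrev E3 : Type := EuclideanSpace ℝ (Fin 3)

/-- The `i`-th standard basis vector of `ℝ³`. -/
def e (i : Fin 3) : E3 := EuclideanSpace.single i 1

/-- The vector `σ = (1, 1, 1)`. -/
def sigma : E3 := !₂[1, 1, 1]

/-- The (almost everywhere defined) vector field `u` belongs to `H^s(ℝ³; ℝ³)`, for `s ≥ 0`:
every component, seen as a complex valued function, is (almost everywhere equal to) an `L²`
function whose associated tempered distribution lies in the `L²`-based Sobolev space of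
order `s`, that is, `(1 + |ξ|²)^{s/2} û_i` is in `L²`. -/
def MemHs (s : ℝ) (u : E3 → E3) : Prop :=
  ∀ i : Fin 3, ∃ f : Lp ℂ 2 (volume : Measure E3),
    (∀ᵐ x : E3, ((u x i : ℝ) : ℂ) = f x) ∧
      TemperedDistribution.MemSobolev s 2 (f : 𝓢'(E3, ℂ))

/-- `∇ · u = 0` in the sense of distributions: `∫ u · ∇φ = 0` for all real test functions `φ`. -/
def WeaklyDivFree (u : E3 → E3) : Prop :=
  ∀ φ : E3 → ℝ, ContDiff ℝ ∞ φ → HasCompactSupport φ →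
    ∫ x : E3, ∑ i : Fin 3, u x i * fderiv ℝ φ x (e i) = 0

/-- The space `H^s_df` of divergence free vector fields in `H^s(ℝ³; ℝ³)`. -/
def MemHsDf (s : ℝ) (u : E3 → E3) : Prop :=
  MemHs s u ∧ WeaklyDivFree u

/-- The transformed field `u^Q(x) = Q u(Qᵗ x)`. -/
def transform (Q : Matrix (Fin 3) (Fin 3) ℝ) (u : E3 → E3) : E3 → E3 := fun x =>
  Matrix.toEuclideanLin Q (u (Matrix.toEuclideanLin Q.transpose x))

/-- `u` is permutation symmetric: `u^P = u` almost everywhere, for each of the six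
permutation matrices `P`. -/
def PermutationSymmetric (u : E3 → E3) : Prop :=
  ∀ π : Equiv.Perm (Fin 3), transform (π.permMatrix ℝ) u =ᵐ[volume] u

/-- The gradient matrix `(∇u)_{ij} = ∂_i u_j` of a differentiable vector field. -/
def grad (u : E3 → E3) (x : E3) : Matrix (Fin 3) (Fin 3) ℝ :=
  Matrix.of fun i j => fderiv ℝ u x (e i) j

/-- The vorticity `ω = ∇ × u` of a differentiable vector field. -/
def curl (u : E3 → E3) (x : E3) : E3 :=
  !₂[grad u x 1 2 - grad u x 2 1, grad u x 2 0 - grad u x 0 2, grad u x 0 1 - grad u x 1 0]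

/-- The integrand `(σ · x)(x_j - x_k) |x|⁻⁵ ω_i(x)`. -/
def lambdaIntegrand (U : E3 → E3) (i j k : Fin 3) (x : E3) : ℝ :=
  (inner ℝ sigma x * (x j - x k) / ‖x‖ ^ 5) * curl U x i

end PermSymm

end

/-! Two ingredients combine: permutation symmetry fixes the shape of `∇u(0)`, and a
potential-theoretic identity recovers its one free parameter from the vorticity.

Fourier inversion and Cauchy–Schwarz give a `C^{1,α}` representative with square integrable gradient
(`exists_contDiff_one_of_memSobolev`). At the fixed point 0, symmetry equates all diagonal entries
of the gradient and all off-diagonal ones; zero divergence kills the diagonal (`grad_zero_eq`). The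
gradient at 0 is therefore symmetric, so `ω(0) = 0` and `|ω| ≤ C|x|^α` tames the `|x|⁻³` kernel,
while `L²` bounds handle infinity (`integrable_curlKer_mul`).

For the value, let `K_ij` be the Hessian of `(|x|² + ε²)^{-1/2}`. Summing `K_ij - K_ik` over `i`
yields three times the kernel in the theorem (`three_mul_curlKer`). Integration by parts and zero
divergence reduce the sum of the three vorticity integrals to the Laplacian of the regularized
potential tested against all `∂_i u_l` (`sum_integral_curlKer`). That Laplacian is minus an
approximate identity of mass `4π` (`tendsto_integral_regNorm_mul`). As `ε → 0`, with the three
integrals equal to a common `I` by cyclic symmetry, `9 I = 24 π λ`. -/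

noncomputable section

namespace PermSymm

open MeasureTheory FourierTransform Real Filter Topology
open scoped SchwartzMap ContDiff ENNReal

/-! ### Sobolev embedding into `C^{1,α}` by Fourier inversion -/

section Fourier

variable {E : Type*} [NormedAddCommGroup E] [InnerProductSpace ℝ E] [FiniteDimensional ℝ E]
  [MeasurableSpace E] [BorelSpace E]

theorem integral_fourier_mul_eq {f g : E → ℂ} (hf : Integrable f) (hg : Integrable g) :
    ∫ x, 𝓕 f x * g x = ∫ x, f x * 𝓕 g x := by
  have := VectorFourier.integral_fourierIntegral_smul_eq_flip (μ := (volume : Measure E))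
    (ν := (volume : Measure E)) (L := innerₗ E) (e := 𝐞) Real.continuous_fourierChar
    (by simpa using continuous_inner) hf hg
  simpa [flip_innerₗ] using! this

theorem integral_mul_fourierInv_eq {f g : E → ℂ} (hf : Integrable f) (hg : Integrable g) :
    ∫ x, f x * 𝓕⁻ g x = ∫ x, 𝓕⁻ f x * g x := by
  have h1 : ∫ x, f x * 𝓕⁻ g x = ∫ x, f (-x) * 𝓕 g x := by
    rw [← integral_neg_eq_self]
    simp [Real.fourierInv_eq_fourier_neg]
  rw [h1, ← integral_fourier_mul_eq hf.comp_neg hg, Real.fourierInv_eq_fourier_comp_neg]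

/-- For functions in `L¹ ∩ L²` the Fourier integral is the `L²` Fourier transform. -/
theorem fourierInv_toLp_ae_eq {h : E → ℂ} (h1 : Integrable h) (h2 : MemLp h 2) :
    ((𝓕⁻ (h2.toLp h) : Lp ℂ 2 (volume : Measure E)) : E → ℂ) =ᵐ[volume] 𝓕⁻ h := by
  have hc : Continuous (𝓕⁻ h : E → ℂ) := by
    rw [Real.fourierInv_eq_fourier_comp_neg]
    exact VectorFourier.fourierIntegral_continuous Real.continuous_fourierChar
      (by simpa using continuous_inner) h1.comp_neg
  apply ae_eq_of_integral_contDiff_smul_eq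
  · exact (Lp.memLp _).locallyIntegrable (by norm_num)
  · exact hc.locallyIntegrable
  · intro φ φ_smooth φ_cpt
    have hφ₁ : HasCompactSupport (Complex.ofRealCLM ∘ φ) := φ_cpt.comp_left rfl
    have hφ₂ : ContDiff ℝ ∞ (Complex.ofRealCLM ∘ φ) := by fun_prop
    set ψ : 𝓢(E, ℂ) := hφ₁.toSchwartzMap hφ₂ with hψ
    have e1 := congrArg (fun T : 𝓢'(E, ℂ) => T ψ)
      (Lp.fourierInv_toTemperedDistribution_eq (h2.toLp h))
    simp only [TemperedDistribution.fourierInv_apply, Lp.toTemperedDistribution_apply] at e1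
    have e2 : ∫ x, (𝓕⁻ ψ : 𝓢(E, ℂ)) x • (h2.toLp h) x = ∫ x, 𝓕⁻ (ψ : E → ℂ) x * h x := by
      apply integral_congr_ae
      filter_upwards [h2.coeFn_toLp] with x hx
      rw [hx, SchwartzMap.fourierInv_coe, smul_eq_mul]
    rw [e2, ← integral_mul_fourierInv_eq ψ.integrable h1] at e1
    simpa [hψ] using! e1.symm

theorem memLp_two_fourierInv {h : E → ℂ} (h1 : Integrable h) (h2 : MemLp h 2) :
    MemLp (𝓕⁻ h : E → ℂ) 2 :=
  (memLp_congr_ae (fourierInv_toLp_ae_eq h1 h2)).1 (Lp.memLp _)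

theorem memLp_two_fourier {h : E → ℂ} (h1 : Integrable h) (h2 : MemLp h 2) :
    MemLp (𝓕 h : E → ℂ) 2 := by
  have := memLp_two_fourierInv h1.comp_neg
    (h2.comp_measurePreserving (Measure.measurePreserving_neg volume))
  rw [Real.fourierInv_eq_fourier_comp_neg] at this
  simpa [Function.comp_def] using! this

theorem memLp_two_rpow_one_add_norm_sq {r : ℝ} (hr : (Module.finrank ℝ E : ℝ) < 2 * r) :
    MemLp (fun x : E ↦ (1 + ‖x‖ ^ 2) ^ (-r / 2)) 2 := by
  have hm : AEStronglyMeasurable (fun x : E ↦ (1 + ‖x‖ ^ 2) ^ (-r / 2)) volume := by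
    have : (fun x : E ↦ (1 + ‖x‖ ^ 2) ^ (-r / 2)).HasTemperateGrowth := by fun_prop
    exact this.1.continuous.aestronglyMeasurable
  rw [memLp_two_iff_integrable_sq hm]
  refine (integrable_rpow_neg_one_add_norm_sq hr).congr (.of_forall fun x ↦ ?_)
  have : (0 : ℝ) ≤ 1 + ‖x‖ ^ 2 := by positivity
  beta_reduce
  rw [← Real.rpow_mul_natCast this]
  congr 1
  push_cast
  ring

/-- The Fourier transform of a Sobolev function is a square integrable function with weights. -/
theorem exists_weighted_fourier {s : ℝ} {f : Lp ℂ 2 (volume : Measure E)}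
    (hs0 : 0 ≤ s) (hf : TemperedDistribution.MemSobolev s 2 (f : 𝓢'(E, ℂ))) :
    ∃ W : E → ℂ, MemLp W 2 ∧
      (𝓕 f : Lp ℂ 2 (volume : Measure E)) =ᵐ[volume]
        fun ξ ↦ (((1 + ‖ξ‖ ^ 2) ^ (-s / 2) : ℝ) : ℂ) * W ξ := by
  obtain ⟨u, hu⟩ := TemperedDistribution.memSobolev_iff_exists_smulLeftCLM_fourier.mp hf
  have tg : (fun x : E ↦ (((1 + ‖x‖ ^ 2) ^ (-s / 2) : ℝ) : ℂ)).HasTemperateGrowth := by fun_prop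
  have hm : MemLp (fun x : E ↦ (((1 + ‖x‖ ^ 2) ^ (-s / 2) : ℝ) : ℂ)) ∞ := by
    refine memLp_top_of_bound tg.1.continuous.aestronglyMeasurable 1 (.of_forall fun x ↦ ?_)
    rw [Complex.norm_real, Real.norm_eq_abs, abs_of_nonneg (by positivity)]
    exact Real.rpow_le_one_of_one_le_of_nonpos (by simp) (by linarith)
  refine ⟨u, Lp.memLp u, ?_⟩
  -- `L²` embeds injectively into tempered distributions, so the identity can be checked there,
  -- where the weights of orders `s` and `-s` cancel.
  have key : (hm.toLp • u : Lp ℂ 2 (volume : Measure E)) = 𝓕 f := by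
    have : LinearMap.ker (Lp.toTemperedDistributionCLM ℂ (volume : Measure E) 2).toLinearMap = ⊥ :=
      Lp.ker_toTemperedDistributionCLM_eq_bot
    apply LinearMap.ker_eq_bot.1 this
    change ((hm.toLp • u : Lp ℂ 2 (volume : Measure E)) : 𝓢'(E, ℂ)) =
      ((𝓕 f : Lp ℂ 2 (volume : Measure E)) : 𝓢'(E, ℂ))
    rw [Lp.toTemperedDistribution_smul_eq tg, ← Lp.fourier_toTemperedDistribution_eq, ← hu,
      TemperedDistribution.smulLeftCLM_smulLeftCLM_apply (by fun_prop) (by fun_prop)]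
    convert! (TemperedDistribution.smulLeftCLM_const 1 (𝓕 (f : 𝓢'(E, ℂ)))) using 1
    · congr
      ext x
      rw [Pi.mul_apply]
      norm_cast
      rw [← Real.rpow_add (by positivity)]
      ring_nf
      simp
    · simp
  rw [← key]
  filter_upwards [Lp.coeFn_lpSMul (r := 2) hm.toLp u, hm.coeFn_toLp] with x hg hg'
  simp only [hg, Pi.smul_apply', hg', smul_eq_mul]

/-- Interpolates between the Lipschitz bound `t = 2π|a - b|` and the trivial bound 2: if `t ≤ 1`
then `t ≤ t ^ α`, otherwise `1 ≤ t ^ α`. -/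
theorem norm_fourierChar_sub_le (a b : ℝ) {α : ℝ} (h0 : 0 < α) (h1 : α ≤ 1) :
    ‖(𝐞 a : ℂ) - 𝐞 b‖ ≤ 2 * (2 * π * |a - b|) ^ α := by
  have hl : ‖(𝐞 a : ℂ) - 𝐞 b‖ ≤ 2 * π * |a - b| := by
    have := Convex.norm_image_sub_le_of_norm_deriv_le (f := fun x : ℝ ↦ (𝐞 x : ℂ)) (C := 2 * π)
      (s := Set.univ) (x := b) (y := a) (fun x _ ↦ Real.differentiable_fourierChar x)
      (fun x _ ↦ by
        rw [Real.deriv_fourierChar]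
        rw [norm_mul, Circle.norm_coe]
        simp [abs_of_pos Real.pi_pos]) convex_univ (Set.mem_univ _) (Set.mem_univ _)
    simpa using this
  set t := 2 * π * |a - b| with ht
  have t0 : 0 ≤ t := by positivity
  rcases le_total t 1 with h | h
  · have : t ≤ t ^ α := by
      rcases t0.eq_or_lt with h' | h'
      · rw [← h', Real.zero_rpow h0.ne']
      · simpa using Real.rpow_le_rpow_of_exponent_ge h' h h1
    have : 0 ≤ t ^ α := by positivity
    linarith
  · have : ‖(𝐞 a : ℂ) - 𝐞 b‖ ≤ 2 := by
      refine (norm_sub_le _ _).trans ?_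
      rw [Circle.norm_coe, Circle.norm_coe]; norm_num
    have := Real.one_le_rpow h h0.le
    linarith

theorem norm_fourier_sub_fourier_le {F : Type*} [NormedAddCommGroup F] [NormedSpace ℂ F]
    {h : E → F} {α : ℝ} (h0 : 0 < α) (h1 : α ≤ 1)
    (hi : Integrable h) (hw : Integrable fun ξ ↦ ‖ξ‖ ^ α * ‖h ξ‖) (x y : E) :
    ‖𝓕 h x - 𝓕 h y‖ ≤ (2 * (2 * π) ^ α * ∫ ξ, ‖ξ‖ ^ α * ‖h ξ‖) * ‖x - y‖ ^ α := by
  have hx (x : E) : Integrable fun v ↦ 𝐞 (-inner ℝ v x) • h v :=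
    (Real.fourierIntegral_convergent_iff x).2 hi
  rw [Real.fourier_eq, Real.fourier_eq, ← integral_sub (hx x) (hx y)]
  have hb (v : E) : ‖𝐞 (-inner ℝ v x) • h v - 𝐞 (-inner ℝ v y) • h v‖ ≤
      (2 * (2 * π) ^ α * ‖x - y‖ ^ α) * (‖v‖ ^ α * ‖h v‖) := by
    rw [Circle.smul_def, Circle.smul_def, ← sub_smul, norm_smul, ← mul_assoc]
    gcongr
    refine (norm_fourierChar_sub_le _ _ h0 h1).trans ?_
    have : |(-inner ℝ v x) - (-inner ℝ v y)| ≤ ‖v‖ * ‖x - y‖ := by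
      rw [show (-inner ℝ v x) - (-inner ℝ v y) = -inner ℝ v (x - y) by rw [inner_sub_right]; ring,
        abs_neg]
      exact abs_real_inner_le_norm _ _
    calc 2 * (2 * π * |(-inner ℝ v x) - (-inner ℝ v y)|) ^ α
        ≤ 2 * (2 * π * (‖v‖ * ‖x - y‖)) ^ α := by gcongr
      _ = _ := by
        rw [Real.mul_rpow (by positivity) (by positivity),
          Real.mul_rpow (norm_nonneg v) (norm_nonneg (x - y))]
        ring
  calc _ ≤ ∫ v, (2 * (2 * π) ^ α * ‖x - y‖ ^ α) * (‖v‖ ^ α * ‖h v‖) :=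
        norm_integral_le_of_norm_le (hw.const_mul _) (.of_forall hb)
    _ = _ := by rw [integral_const_mul]; ring

/-- Sobolev embedding of `H^s` into `C^{1, α}` for `s > d / 2 + 1 + α`. -/
theorem exists_contDiff_one_of_memSobolev {s α : ℝ} (hα0 : 0 < α) (hα1 : α ≤ 1)
    (hs : (Module.finrank ℝ E : ℝ) / 2 + 1 + α < s) {f : Lp ℂ 2 (volume : Measure E)}
    (hf : TemperedDistribution.MemSobolev s 2 (f : 𝓢'(E, ℂ))) :
    ∃ F : E → ℂ, F =ᵐ[volume] f ∧ ContDiff ℝ 1 F ∧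
      (∀ v, MemLp (fun x ↦ fderiv ℝ F x v) 2) ∧ (∃ C, ∀ x, ‖fderiv ℝ F x‖ ≤ C) ∧
      ∃ C : ℝ, ∀ x y, ‖fderiv ℝ F x - fderiv ℝ F y‖ ≤ C * ‖x - y‖ ^ α := by
  have hd : (0 : ℝ) ≤ Module.finrank ℝ E := by positivity
  obtain ⟨W, hW, hfW⟩ := exists_weighted_fourier (by linarith) hf
  set g : E → ℂ := fun ξ ↦ (((1 + ‖ξ‖ ^ 2) ^ (-s / 2) : ℝ) : ℂ) * W ξ with hg
  -- The reflection writes the inverse transform of `g` as the forward transform of `G`, to which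
  -- the differentiation results for `𝓕` apply.
  set G : E → ℂ := fun ξ ↦ g (-ξ) with hG
  have gm : AEStronglyMeasurable g volume := by
    refine AEStronglyMeasurable.mul ?_ hW.1
    have tg : (fun x : E ↦ (((1 + ‖x‖ ^ 2) ^ (-s / 2) : ℝ) : ℂ)).HasTemperateGrowth := by fun_prop
    exact tg.1.continuous.aestronglyMeasurable
  have Gm : AEStronglyMeasurable G volume :=
    gm.comp_measurePreserving (Measure.measurePreserving_neg volume)
  -- weighted integrability
  have wi (β : ℝ) (hβ0 : 0 ≤ β) (hβ : β ≤ 1 + α) : Integrable fun ξ ↦ ‖ξ‖ ^ β * ‖G ξ‖ := by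
    -- Cauchy–Schwarz: `|ξ|^β` costs `β` orders of decay, and `(1 + |ξ|²)^{-(s-β)/2}` is still in
    -- `L²`. The values used are `β = 0` (integrability), `1` (differentiability) and `1 + α`
    -- (Hölder bound).
    have hm := memLp_two_rpow_one_add_norm_sq (E := E) (r := s - β) (by linarith)
    have := (hm.integrable_mul hW.norm)
    have hi : Integrable fun ξ ↦ ‖ξ‖ ^ β * ‖g ξ‖ := by
      refine this.mono' ?_ (.of_forall fun ξ ↦ ?_)
      · exact ((continuous_norm.rpow_const fun _ ↦ .inr hβ0).aestronglyMeasurable).mul gm.norm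
      · rw [Real.norm_of_nonneg (by positivity), hg, norm_mul, Complex.norm_real,
          Real.norm_of_nonneg (by positivity), ← mul_assoc, Pi.mul_apply]
        gcongr
        have h1 : ‖ξ‖ ^ β ≤ (1 + ‖ξ‖ ^ 2) ^ (β / 2) := by
          calc ‖ξ‖ ^ β = (‖ξ‖ ^ 2) ^ (β / 2) := by
                rw [← Real.rpow_natCast, ← Real.rpow_mul (by positivity)]
                congr 1; push_cast; ring
            _ ≤ _ := by gcongr; linarith
        calc _ ≤ (1 + ‖ξ‖ ^ 2) ^ (β / 2) * (1 + ‖ξ‖ ^ 2) ^ (-s / 2) := by gcongr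
          _ = _ := by rw [← Real.rpow_add (by positivity)]; congr 1; ring
    simpa [hG] using hi.comp_neg
  have hG1 : Integrable G := by
    have := wi 0 le_rfl (by linarith)
    simp only [Real.rpow_zero, one_mul] at this
    exact (integrable_norm_iff Gm).1 this
  have hG2 : Integrable fun ξ ↦ ‖ξ‖ * ‖G ξ‖ := by
    simpa using wi 1 zero_le_one (by linarith)
  have g1 : Integrable g := by simpa [hG] using hG1.comp_neg
  have g2 : MemLp g 2 := (memLp_congr_ae hfW).1 (Lp.memLp _)
  have hFG : (𝓕 G : E → ℂ) = 𝓕⁻ g := by rw [Real.fourierInv_eq_fourier_comp_neg]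
  have hfd := Real.fderiv_fourier hG1 hG2
  set H := VectorFourier.fourierSMulRight (innerSL ℝ) G with hH
  have nH (ξ : E) : ‖H ξ‖ ≤ 2 * π * (‖ξ‖ * ‖G ξ‖) := by
    refine (VectorFourier.norm_fourierSMulRight_le _ _ _).trans ?_
    have : ‖innerSL ℝ (E := E)‖ ≤ 1 := norm_innerSL_le ℝ
    have : 2 * π * ‖innerSL ℝ (E := E)‖ ≤ 2 * π * 1 := by gcongr
    calc _ ≤ 2 * π * 1 * ‖ξ‖ * ‖G ξ‖ := by gcongr
      _ = _ := by ring
  have Hm : AEStronglyMeasurable H volume := Gm.fourierSMulRight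
  have H1 : Integrable H := (hG2.const_mul (2 * π)).mono' Hm (.of_forall nH)
  refine ⟨𝓕 G, ?_, ?_, ?_, ?_, 2 * (2 * π) ^ α * ∫ ξ, ‖ξ‖ ^ α * ‖H ξ‖, ?_⟩
  · have h1 := fourierInv_toLp_ae_eq g1 g2
    have h2 : g2.toLp g = 𝓕 f := by
      apply Lp.ext
      filter_upwards [g2.coeFn_toLp, hfW] with x hx hx'
      rw [hx, hx']
    rw [h2, fourierInv_fourier_eq] at h1
    rw [hFG]
    exact h1.symm
  · refine Real.contDiff_fourier (N := 1) fun n hn ↦ ?_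
    have hn' : n ≤ 1 := by exact_mod_cast hn
    interval_cases n
    · simpa using hG1.norm
    · simpa using hG2
  · intro v
    have e1 : (fun x ↦ fderiv ℝ (𝓕 G) x v) = 𝓕 fun ξ ↦ H ξ v := by
      ext x
      rw [hfd]
      exact (Real.fourier_continuousLinearMap_apply H1).symm ▸ rfl
    rw [e1]
    have hHv : Integrable fun ξ ↦ H ξ v := H1.apply_continuousLinearMap v
    refine memLp_two_fourier hHv ?_
    have hWn : MemLp (fun ξ ↦ W (-ξ)) 2 :=
      hW.comp_measurePreserving (Measure.measurePreserving_neg volume)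
    refine hWn.of_le_mul (c := 2 * π * ‖v‖) hHv.1 (.of_forall fun ξ ↦ ?_)
    -- Since `s ≥ 1`, the Sobolev weight absorbs one factor `|ξ|`.
    have hle : ‖ξ‖ * ‖G ξ‖ ≤ ‖W (-ξ)‖ := by
      have hb : (1 : ℝ) ≤ 1 + ‖ξ‖ ^ 2 := by simp
      have : ‖ξ‖ * (1 + ‖ξ‖ ^ 2) ^ (-s / 2) ≤ 1 := by
        have h1 : ‖ξ‖ ≤ (1 + ‖ξ‖ ^ 2) ^ (1 / 2 : ℝ) := by
          rw [← Real.sqrt_eq_rpow]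
          apply Real.le_sqrt_of_sq_le; linarith
        have h2 : (1 + ‖ξ‖ ^ 2) ^ (-s / 2) ≤ (1 + ‖ξ‖ ^ 2) ^ (-(1 / 2) : ℝ) :=
          Real.rpow_le_rpow_of_exponent_le hb (by linarith)
        calc _ ≤ (1 + ‖ξ‖ ^ 2) ^ (1 / 2 : ℝ) * (1 + ‖ξ‖ ^ 2) ^ (-(1 / 2) : ℝ) := by gcongr
          _ = 1 := by rw [← Real.rpow_add (by positivity)]; simp
      simp only [hG, hg, norm_mul, Complex.norm_real, norm_neg]
      rw [Real.norm_of_nonneg (by positivity), ← mul_assoc]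
      exact mul_le_of_le_one_left (norm_nonneg _) this
    calc ‖H ξ v‖ ≤ ‖H ξ‖ * ‖v‖ := (H ξ).le_opNorm v
      _ ≤ 2 * π * (‖ξ‖ * ‖G ξ‖) * ‖v‖ := by gcongr; exact nH ξ
      _ ≤ 2 * π * ‖W (-ξ)‖ * ‖v‖ := by gcongr
      _ = _ := by ring
  · refine ⟨∫ ξ, ‖H ξ‖, fun x ↦ ?_⟩
    rw [hfd]
    exact VectorFourier.norm_fourierIntegral_le_integral_norm _ _ _ _ _
  · intro x y
    rw [hfd]
    refine norm_fourier_sub_fourier_le hα0 hα1 H1 ?_ x y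
    refine ((wi (1 + α) (by linarith) le_rfl).const_mul (2 * π)).mono' ?_ (.of_forall fun ξ ↦ ?_)
    · exact ((continuous_norm.rpow_const fun _ ↦ .inr hα0.le).aestronglyMeasurable).mul Hm.norm
    · rw [Real.norm_of_nonneg (by positivity)]
      calc ‖ξ‖ ^ α * ‖H ξ‖ ≤ ‖ξ‖ ^ α * (2 * π * (‖ξ‖ * ‖G ξ‖)) := by gcongr; exact nH ξ
        _ = 2 * π * (‖ξ‖ ^ (1 + α) * ‖G ξ‖) := by
          rw [Real.rpow_one_add' (by positivity) (by linarith)]; ring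

end Fourier

/-! ### The regularized Newtonian kernel and its derivatives -/

/-- The regularized norm `(|x|² + ε²)^{1/2}`. -/
def regNorm (ε : ℝ) (x : E3) : ℝ := √(‖x‖ ^ 2 + ε ^ 2)

/-- The Kronecker symbol. -/
def kron (i j : Fin 3) : ℝ := if i = j then 1 else 0

theorem kron_comm (i j : Fin 3) : kron i j = kron j i := by
  simp [kron, eq_comm]

theorem abs_kron_le (i j : Fin 3) : |kron i j| ≤ 1 := by
  unfold kron; split_ifs <;> simp

/-- The second derivatives of the regularized Newtonian kernel `(|x|² + ε²)^{-1/2}`. -/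
def kerHess (ε : ℝ) (i j : Fin 3) (x : E3) : ℝ :=
  3 * x i * x j / regNorm ε x ^ 5 - kron i j / regNorm ε x ^ 3

/-- The third derivatives of the regularized Newtonian kernel `(|x|² + ε²)^{-1/2}`. -/
def kerThird (ε : ℝ) (i j k : Fin 3) (x : E3) : ℝ :=
  3 * (kron i j * x k + kron i k * x j + kron j k * x i) / regNorm ε x ^ 5 -
    15 * x i * x j * x k / regNorm ε x ^ 7

section Kernel

variable {ε : ℝ}

theorem regNorm_pos (hε : 0 < ε) (x : E3) : 0 < regNorm ε x := by
  unfold regNorm; positivity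

theorem regNorm_sq (x : E3) : regNorm ε x ^ 2 = ‖x‖ ^ 2 + ε ^ 2 :=
  Real.sq_sqrt (by positivity)

theorem norm_le_regNorm (x : E3) : ‖x‖ ≤ regNorm ε x :=
  Real.le_sqrt_of_sq_le (by linarith [sq_nonneg ε])

theorem abs_apply_le_regNorm (x : E3) (i : Fin 3) : |x i| ≤ regNorm ε x :=
  (PiLp.norm_apply_le x i).trans (norm_le_regNorm x)

theorem continuous_regNorm : Continuous (regNorm ε) := by
  unfold regNorm; fun_prop

theorem hasFDerivAt_regNorm (hε : 0 < ε) (x : E3) :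
    HasFDerivAt (regNorm ε) ((regNorm ε x)⁻¹ • innerSL ℝ x) x := by
  have h1 : HasFDerivAt (fun y : E3 ↦ ‖y‖ ^ 2 + ε ^ 2) (2 • innerSL ℝ x) x :=
    ((hasStrictFDerivAt_norm_sq x).hasFDerivAt).add_const _
  have h2 := h1.sqrt (by positivity)
  refine h2.congr_fderiv ?_
  have := (regNorm_pos hε x).ne'
  ext v
  simp only [smul_apply, smul_eq_mul, nsmul_eq_mul, regNorm] at *
  field_simp
  push_cast
  ring

theorem hasLineDerivAt_regNorm (hε : 0 < ε) (x : E3) (k : Fin 3) :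
    HasLineDerivAt ℝ (regNorm ε) (x k / regNorm ε x) x (e k) := by
  have h := (hasFDerivAt_regNorm hε x).hasLineDerivAt (e k)
  have h2 : ((regNorm ε x)⁻¹ • innerSL ℝ x) (e k) = x k / regNorm ε x := by
    simp [e, EuclideanSpace.inner_single_right, div_eq_inv_mul]
  rwa [h2] at h

theorem differentiable_regNorm (hε : 0 < ε) : Differentiable ℝ (regNorm ε) :=
  fun x ↦ (hasFDerivAt_regNorm hε x).differentiableAt

theorem differentiable_kerHess (hε : 0 < ε) (i j : Fin 3) : Differentiable ℝ (kerHess ε i j) := by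
  unfold kerHess
  have h := differentiable_regNorm hε
  have h0 (x : E3) := (regNorm_pos hε x).ne'
  have hc (i : Fin 3) : Differentiable ℝ fun x : E3 ↦ x i :=
    (EuclideanSpace.proj (𝕜 := ℝ) i).differentiable
  simp_rw [div_eq_mul_inv]
  exact (((hc i).const_mul 3 |>.mul (hc j)).mul
    ((h.pow 5).inv fun x ↦ pow_ne_zero _ (h0 x))).sub
    (((h.pow 3).inv fun x ↦ pow_ne_zero _ (h0 x)).const_mul _)

theorem fderiv_kerHess (hε : 0 < ε) (i j k : Fin 3) (x : E3) :
    fderiv ℝ (kerHess ε i j) x (e k) = kerThird ε i j k x := by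
  rw [← (differentiable_kerHess hε i j x).lineDeriv_eq_fderiv]
  refine HasLineDerivAt.lineDeriv ?_
  have hr := hasLineDerivAt_regNorm hε x k
  have hc (i : Fin 3) : HasDerivAt (fun t : ℝ ↦ (x + t • e k) i) (kron i k) 0 := by
    have : (fun t : ℝ ↦ (x + t • e k) i) = fun t ↦ x i + t * kron i k := by
      ext t; simp [e, kron]
    rw [this]
    simpa using ((hasDerivAt_id (0 : ℝ)).mul_const (kron i k)).const_add (x i)
  unfold HasLineDerivAt at hr ⊢
  have h0 := (regNorm_pos hε x).ne'
  have h0' : regNorm ε (x + (0 : ℝ) • e k) ≠ 0 := by simpa using h0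
  convert! ((((hc i).const_mul 3).mul (hc j)).div (hr.pow 5) (pow_ne_zero _ h0')).sub
    ((hasDerivAt_const (0 : ℝ) (kron i j)).div (hr.pow 3) (pow_ne_zero _ h0')) using 1
  simp only [zero_smul, add_zero, kerThird, Pi.pow_apply, Pi.mul_apply]
  rw [kron_comm i k, kron_comm j k]
  field_simp
  push_cast
  ring

theorem kerThird_swap (i j k : Fin 3) (x : E3) : kerThird ε i j k x = kerThird ε i k j x := by
  simp only [kerThird, kron_comm k j]; ring

theorem abs_kerHess_le (hε : 0 < ε) (i j : Fin 3) (x : E3) :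
    |kerHess ε i j x| ≤ 4 / regNorm ε x ^ 3 := by
  have h0 := regNorm_pos hε x
  have hi := abs_apply_le_regNorm (ε := ε) x i
  have hj := abs_apply_le_regNorm (ε := ε) x j
  calc |kerHess ε i j x| ≤ |3 * x i * x j / regNorm ε x ^ 5| + |kron i j / regNorm ε x ^ 3| :=
        abs_sub _ _
    _ = 3 * |x i| * |x j| / regNorm ε x ^ 5 + |kron i j| / regNorm ε x ^ 3 := by
        simp only [abs_div, abs_mul, abs_pow, abs_of_pos h0]; norm_num
    _ ≤ 3 * regNorm ε x * regNorm ε x / regNorm ε x ^ 5 + 1 / regNorm ε x ^ 3 := by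
        gcongr; exact abs_kron_le i j
    _ = 4 / regNorm ε x ^ 3 := by field_simp; norm_num

theorem abs_kerThird_le (hε : 0 < ε) (i j k : Fin 3) (x : E3) :
    |kerThird ε i j k x| ≤ 24 / regNorm ε x ^ 4 := by
  have h0 := regNorm_pos hε x
  have hx := abs_apply_le_regNorm (ε := ε) x
  have hk (i j k : Fin 3) : |kron i j * x k| ≤ regNorm ε x := by
    rw [abs_mul]
    calc _ ≤ 1 * regNorm ε x := by gcongr; exacts [abs_kron_le i j, hx k]
      _ = _ := one_mul _
  calc |kerThird ε i j k x| ≤ |3 * (kron i j * x k + kron i k * x j + kron j k * x i) /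
          regNorm ε x ^ 5| + |15 * x i * x j * x k / regNorm ε x ^ 7| := abs_sub _ _
    _ = 3 * |kron i j * x k + kron i k * x j + kron j k * x i| / regNorm ε x ^ 5 +
        15 * |x i| * |x j| * |x k| / regNorm ε x ^ 7 := by
        simp only [abs_div, abs_mul, abs_pow, abs_of_pos h0]; norm_num
    _ ≤ 3 * (regNorm ε x + regNorm ε x + regNorm ε x) / regNorm ε x ^ 5 +
        15 * regNorm ε x * regNorm ε x * regNorm ε x / regNorm ε x ^ 7 := by
        gcongr
        · exact (abs_add_three _ _ _).trans
            (add_le_add (add_le_add (hk i j k) (hk i k j)) (hk j k i))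
        all_goals apply hx
    _ = 24 / regNorm ε x ^ 4 := by field_simp; norm_num

theorem continuous_kerHess (hε : 0 < ε) (i j : Fin 3) : Continuous (kerHess ε i j) :=
  (differentiable_kerHess hε i j).continuous

theorem continuous_kerThird (hε : 0 < ε) (i j k : Fin 3) : Continuous (kerThird ε i j k) := by
  unfold kerThird
  have h := continuous_regNorm (ε := ε)
  have h0 (x : E3) := (regNorm_pos hε x).ne'
  exact (Continuous.div (by fun_prop) (h.pow 5) fun x ↦ pow_ne_zero _ (h0 x)).sub
    (Continuous.div (by fun_prop) (h.pow 7) fun x ↦ pow_ne_zero _ (h0 x))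

theorem regNorm_one_pow_inv (n : ℕ) (x : E3) :
    1 / regNorm 1 x ^ n = (1 + ‖x‖ ^ 2) ^ (-(n : ℝ) / 2) := by
  have : (0 : ℝ) ≤ 1 + ‖x‖ ^ 2 := by positivity
  rw [regNorm, one_pow, add_comm, Real.sqrt_eq_rpow, ← Real.rpow_mul_natCast this, one_div,
    ← Real.rpow_neg this]
  congr 1; ring

theorem memLp_two_one_div_regNorm_pow (hε : 0 < ε) {n : ℕ} (hn : 2 ≤ n) :
    MemLp (fun x ↦ 1 / regNorm ε x ^ n) 2 := by
  have h1 : MemLp (fun x : E3 ↦ 1 / regNorm 1 x ^ n) 2 := by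
    simp_rw [regNorm_one_pow_inv]
    apply memLp_two_rpow_one_add_norm_sq
    have : (2 : ℝ) ≤ n := by exact_mod_cast hn
    simp; linarith
  have h0 (x : E3) := regNorm_pos hε x
  -- With this `c`, `c * regNorm 1 x ≤ regNorm ε x`, which reduces the claim to `ε = 1`.
  set c := min 1 ε with hc
  have hc0 : 0 < c := lt_min one_pos hε
  refine h1.of_le_mul (c := 1 / c ^ n) ?_ (.of_forall fun x ↦ ?_)
  · exact (continuous_const.div (continuous_regNorm.pow n)
      fun x ↦ pow_ne_zero _ (h0 x).ne').aestronglyMeasurable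
  · have h2 : c * regNorm 1 x ≤ regNorm ε x := by
      apply Real.le_sqrt_of_sq_le
      rw [mul_pow, regNorm_sq]
      have a1 : c ^ 2 ≤ 1 := by
        have : c ≤ 1 := min_le_left _ _
        nlinarith
      have a2 : c ^ 2 ≤ ε ^ 2 := by
        have : c ≤ ε := min_le_right _ _
        gcongr
      nlinarith [sq_nonneg ‖x‖]
    have h3 := regNorm_pos one_pos x
    have h4 := h0 x
    rw [Real.norm_of_nonneg (by positivity), Real.norm_of_nonneg (by positivity),
      div_mul_div_comm, one_mul, ← mul_pow]
    gcongr

theorem memLp_two_kerHess (hε : 0 < ε) (i j : Fin 3) : MemLp (kerHess ε i j) 2 := by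
  refine (memLp_two_one_div_regNorm_pow hε (n := 3) (by norm_num)).of_le_mul (c := 4)
    (continuous_kerHess hε i j).aestronglyMeasurable (.of_forall fun x ↦ ?_)
  have := regNorm_pos hε x
  rw [Real.norm_of_nonneg (by positivity : 0 ≤ 1 / regNorm ε x ^ 3), mul_one_div]
  exact abs_kerHess_le hε i j x

theorem memLp_two_kerThird (hε : 0 < ε) (i j k : Fin 3) : MemLp (kerThird ε i j k) 2 := by
  refine (memLp_two_one_div_regNorm_pow hε (n := 4) (by norm_num)).of_le_mul (c := 24)
    (continuous_kerThird hε i j k).aestronglyMeasurable (.of_forall fun x ↦ ?_)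
  have := regNorm_pos hε x
  rw [Real.norm_of_nonneg (by positivity : 0 ≤ 1 / regNorm ε x ^ 4), mul_one_div]
  exact abs_kerThird_le hε i j k x

/-- The trace is the Laplacian of the regularized potential; substituting `|x|² = r² - ε²` leaves
only the `ε²` term. -/
theorem sum_kerHess_diag (hε : 0 < ε) (x : E3) :
    ∑ i, kerHess ε i i x = -(3 * ε ^ 2 / regNorm ε x ^ 5) := by
  have h0 := (regNorm_pos hε x).ne'
  have h1 : x 0 ^ 2 + x 1 ^ 2 + x 2 ^ 2 = regNorm ε x ^ 2 - ε ^ 2 := by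
    rw [regNorm_sq, EuclideanSpace.norm_sq_eq]
    simp [Fin.sum_univ_three]
  simp only [kerHess, Fin.sum_univ_three, kron, if_true]
  field_simp
  linear_combination 3 * h1

/-- Moving one derivative across the kernel. -/
theorem integral_kerHess_mul_fderiv (hε : 0 < ε) {V : E3 → ℝ} (hV : Differentiable ℝ V)
    (hV2 : MemLp V 2) (i j k : Fin 3) (hk : MemLp (fun x ↦ fderiv ℝ V x (e k)) 2) :
    ∫ x, kerHess ε i j x * fderiv ℝ V x (e k) = -∫ x, kerThird ε i j k x * V x := by
  rw [integral_mul_fderiv_eq_neg_fderiv_mul_of_integrable]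
  · simp_rw [fderiv_kerHess hε]
  · simp_rw [fderiv_kerHess hε]
    exact (memLp_two_kerThird hε i j k).integrable_mul hV2
  · exact (memLp_two_kerHess hε i j).integrable_mul hk
  · exact (memLp_two_kerHess hε i j).integrable_mul hV2
  · exact fun x _ ↦ differentiable_kerHess hε i j x
  · exact fun x _ ↦ hV x

/-- After integration by parts only the third derivatives of the potential appear, and these are
symmetric in their indices. -/
theorem integral_kerHess_mul_fderiv_swap (hε : 0 < ε) {V : E3 → ℝ} (hV : Differentiable ℝ V)
    (hV2 : MemLp V 2) (hd : ∀ k, MemLp (fun x ↦ fderiv ℝ V x (e k)) 2) (i j k : Fin 3) :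
    ∫ x, kerHess ε i j x * fderiv ℝ V x (e k) = ∫ x, kerHess ε i k x * fderiv ℝ V x (e j) := by
  rw [integral_kerHess_mul_fderiv hε hV hV2 i j k (hd k),
    integral_kerHess_mul_fderiv hε hV hV2 i k j (hd j)]
  simp_rw [kerThird_swap i j k]

end Kernel

/-! ### The approximate identity of mass `4π` -/

section Mass

/-- An explicit antiderivative of the radial mass density; it increases from 0 at the origin to 1 at
infinity. -/
theorem hasDerivAt_pow_three_div (r : ℝ) :
    HasDerivAt (fun r : ℝ ↦ (r / √(r ^ 2 + 1)) ^ 3) (r ^ 2 * (3 / √(r ^ 2 + 1) ^ 5)) r := by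
  have h0 : (0 : ℝ) < r ^ 2 + 1 := by positivity
  have h1 : √(r ^ 2 + 1) ≠ 0 := by positivity
  have h2 : √(r ^ 2 + 1) ^ 2 = r ^ 2 + 1 := Real.sq_sqrt h0.le
  have h3 := (((hasDerivAt_pow 2 r).add_const 1).sqrt h0.ne')
  convert! ((hasDerivAt_id r).div h3 h1).pow 3 using 1
  simp only [id, Pi.div_apply]
  generalize √(r ^ 2 + 1) = q at *
  push_cast
  field_simp
  linear_combination (-(r ^ 2)) * h2

theorem tendsto_div_sqrt_sq_add_one :
    Tendsto (fun r : ℝ ↦ (r / √(r ^ 2 + 1)) ^ 3) atTop (𝓝 1) := by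
  have h1 : Tendsto (fun r : ℝ ↦ (√(1 - (r ^ 2 + 1)⁻¹)) ^ 3) atTop (𝓝 ((√(1 - 0)) ^ 3)) := by
    refine ((Real.continuous_sqrt.tendsto _).comp (tendsto_const_nhds.sub ?_)).pow 3
    exact tendsto_inv_atTop_zero.comp
      (tendsto_atTop_add_const_right _ _ (tendsto_pow_atTop two_ne_zero))
  simp only [sub_zero, Real.sqrt_one, one_pow] at h1
  refine h1.congr' ?_
  filter_upwards [eventually_ge_atTop 0] with r hr
  congr 1
  rw [show 1 - (r ^ 2 + 1)⁻¹ = r ^ 2 / (r ^ 2 + 1) by field_simp; ring,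
    Real.sqrt_div (by positivity), Real.sqrt_sq hr]

theorem integral_three_div_regNorm_one :
    ∫ x : E3, 3 / regNorm 1 x ^ 5 = 4 * π := by
  have h := integral_fun_norm_addHaar (volume : Measure E3) (fun r : ℝ ↦ 3 / √(r ^ 2 + 1) ^ 5)
  have hr : ∫ y in Set.Ioi (0 : ℝ), y ^ 2 * (3 / √(y ^ 2 + 1) ^ 5) = 1 := by
    rw [integral_Ioi_of_hasDerivAt_of_nonneg' (fun r _ ↦ hasDerivAt_pow_three_div r)
      (fun r _ ↦ by positivity) tendsto_div_sqrt_sq_add_one]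
    simp
  have hb : (volume : Measure E3).real (Metric.ball 0 1) = π * 4 / 3 := by
    rw [measureReal_def, EuclideanSpace.volume_ball_fin_three]
    rw [ENNReal.ofReal_one, one_pow, one_mul, ENNReal.toReal_ofReal (by positivity)]
  simp only [regNorm, one_pow]
  rw [h]
  simp only [finrank_euclideanSpace, Fintype.card_fin, smul_eq_mul, nsmul_eq_mul, hb]
  norm_num [hr]
  ring

/-- The Laplacians of the regularized kernels are an approximate identity of mass `4π`. -/
theorem tendsto_integral_regNorm_mul {v : E3 → ℝ} (hv : Continuous v) {C : ℝ}
    (hC : ∀ x, |v x| ≤ C) :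
    Tendsto (fun ε : ℝ ↦ ∫ x, 3 * ε ^ 2 / regNorm ε x ^ 5 * v x) (𝓝[>] 0) (𝓝 (4 * π * v 0)) := by
  have hint : Integrable fun x : E3 ↦ 3 / regNorm 1 x ^ 5 := by
    have := (memLp_two_one_div_regNorm_pow one_pos (n := 2) (by norm_num)).integrable_mul
      (memLp_two_one_div_regNorm_pow one_pos (n := 3) (by norm_num))
    refine (this.const_mul 3).congr (.of_forall fun x ↦ ?_)
    simp only [Pi.mul_apply]
    have := (regNorm_pos one_pos x).ne'
    field_simp
  -- Rescaling by `ε` fixes the kernel and moves `ε` into the argument of `v`, so dominated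
  -- convergence applies.
  have hscale : ∀ ε : ℝ, 0 < ε → ∫ x, 3 * ε ^ 2 / regNorm ε x ^ 5 * v x =
      ∫ x, 3 / regNorm 1 x ^ 5 * v (ε • x) := by
    intro ε hε
    have := Measure.integral_comp_smul_of_nonneg (volume : Measure E3)
      (fun x ↦ 3 * ε ^ 2 / regNorm ε x ^ 5 * v x) ε (hR := hε.le)
    have h2 : ∀ x : E3, 3 * ε ^ 2 / regNorm ε (ε • x) ^ 5 * v (ε • x) =
        (ε ^ 3)⁻¹ * (3 / regNorm 1 x ^ 5 * v (ε • x)) := by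
      intro x
      have hr : regNorm ε (ε • x) = ε * regNorm 1 x := by
        rw [regNorm, regNorm, norm_smul, Real.norm_of_nonneg hε.le,
          show (ε * ‖x‖) ^ 2 + ε ^ 2 = ε ^ 2 * (‖x‖ ^ 2 + 1 ^ 2) by ring,
          Real.sqrt_mul (by positivity), Real.sqrt_sq hε.le]
      rw [hr]
      have := (regNorm_pos one_pos x).ne'
      field_simp
    simp_rw [h2] at this
    rw [integral_const_mul] at this
    simp only [finrank_euclideanSpace, Fintype.card_fin, smul_eq_mul] at this
    exact (mul_left_cancel₀ (by positivity) this).symm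
  have hlim : Tendsto (fun ε : ℝ ↦ ∫ x : E3, 3 / regNorm 1 x ^ 5 * v (ε • x)) (𝓝[>] 0)
      (𝓝 (∫ x : E3, 3 / regNorm 1 x ^ 5 * v 0)) := by
    refine tendsto_integral_filter_of_dominated_convergence
      (fun x ↦ 3 / regNorm 1 x ^ 5 * C) ?_ ?_ (hint.mul_const C) ?_
    · exact .of_forall fun ε ↦ hint.1.mul (by fun_prop)
    · refine .of_forall fun ε ↦ .of_forall fun x ↦ ?_
      have := regNorm_pos one_pos x
      rw [norm_mul, Real.norm_of_nonneg (by positivity)]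
      gcongr
      exact hC _
    · refine .of_forall fun x ↦ Tendsto.const_mul _ ?_
      have : Continuous fun ε : ℝ ↦ v (ε • x) := by fun_prop
      simpa using (this.tendsto 0).mono_left nhdsWithin_le_nhds
  rw [integral_mul_const, integral_three_div_regNorm_one] at hlim
  refine hlim.congr' ?_
  filter_upwards [self_mem_nhdsWithin] with ε hε
  exact (hscale ε hε).symm

end Mass

theorem exists_contDiff_one_of_memSobolev_real {s α : ℝ} (hα0 : 0 < α) (hα1 : α ≤ 1)
    (hs : 5 / 2 + α < s) {w : E3 → ℝ}
    {f : Lp ℂ 2 (volume : Measure E3)} (hwf : ∀ᵐ x : E3, ((w x : ℝ) : ℂ) = f x)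
    (hf : TemperedDistribution.MemSobolev s 2 (f : 𝓢'(E3, ℂ))) :
    ∃ V : E3 → ℝ, V =ᵐ[volume] w ∧ ContDiff ℝ 1 V ∧ MemLp V 2 ∧
      (∀ v, MemLp (fun x ↦ fderiv ℝ V x v) 2) ∧ (∃ C, ∀ x, ‖fderiv ℝ V x‖ ≤ C) ∧
      ∃ C : ℝ, ∀ x y, ‖fderiv ℝ V x - fderiv ℝ V y‖ ≤ C * ‖x - y‖ ^ α := by
  obtain ⟨F, hFf, hF, hF2, ⟨C, hC⟩, C', hC'⟩ :=
    exists_contDiff_one_of_memSobolev hα0 hα1 (by simp; linarith) hf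
  have hfd (x : E3) : fderiv ℝ (fun y ↦ (F y).re) x = Complex.reCLM ∘L fderiv ℝ F x :=
    (Complex.reCLM.hasFDerivAt.comp x (hF.differentiable one_ne_zero x).hasFDerivAt).fderiv
  have hle (T : E3 →L[ℝ] ℂ) : ‖Complex.reCLM ∘L T‖ ≤ ‖T‖ := by
    refine (ContinuousLinearMap.opNorm_comp_le _ _).trans ?_
    simp
  have hFw : (fun x ↦ (F x).re) =ᵐ[volume] w := by
    filter_upwards [hFf, hwf] with x h1 h2
    rw [h1, ← h2, Complex.ofReal_re]
  refine ⟨fun x ↦ (F x).re, hFw, Complex.reCLM.contDiff.comp hF, ?_, fun v ↦ ?_,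
    ⟨C, fun x ↦ ?_⟩, C', fun x y ↦ ?_⟩
  · exact ((memLp_congr_ae hFf).2 (Lp.memLp f)).re
  · simp_rw [hfd]
    exact (hF2 v).re
  · rw [hfd]
    exact (hle _).trans (hC x)
  · rw [hfd, hfd, ← ContinuousLinearMap.comp_sub]
    exact (hle _).trans (hC' x y)

/-! ### Absolute convergence and removal of the regularization -/

section Singular

/-- The kernel `(σ · x)(x_j - x_k) (|x|² + ε²)^{-5/2}`. -/
def curlKer (ε : ℝ) (j k : Fin 3) (x : E3) : ℝ :=
  inner ℝ sigma x * (x j - x k) / regNorm ε x ^ 5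

theorem inner_sigma (x : E3) : inner ℝ sigma x = ∑ i, x i := by
  simp [sigma, PiLp.inner_apply, Fin.sum_univ_three]

theorem regNorm_zero (x : E3) : regNorm 0 x = ‖x‖ := by
  simp [regNorm]

/-- Each column sum of the Hessian is `3 (σ · x) x_j / r⁵ - 1 / r³`, and the second term cancels in
a difference of columns. -/
theorem three_mul_curlKer {ε : ℝ} {j k : Fin 3} (x : E3) :
    3 * curlKer ε j k x = ∑ i, (kerHess ε i j x - kerHess ε i k x) := by
  have h (j : Fin 3) : ∑ i, kron i j = 1 := by simp [kron]
  have : ∑ i, (kerHess ε i j x - kerHess ε i k x) =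
      3 * ((∑ i, x i) * (x j - x k)) / regNorm ε x ^ 5 -
        (∑ i, kron i j) / regNorm ε x ^ 3 + (∑ i, kron i k) / regNorm ε x ^ 3 := by
    simp only [kerHess, Fin.sum_univ_three]
    ring
  rw [this, h, h, curlKer, inner_sigma]
  ring

theorem abs_curlKer_le_abs_curlKer_zero (ε : ℝ) (j k : Fin 3) (x : E3) :
    |curlKer ε j k x| ≤ |curlKer 0 j k x| := by
  rcases eq_or_ne x 0 with rfl | hx
  · simp [curlKer]
  · have h0 : 0 < ‖x‖ := norm_pos_iff.2 hx
    have h1 := norm_le_regNorm (ε := ε) x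
    have h2 := h0.trans_le h1
    simp only [curlKer, regNorm_zero, abs_div, abs_pow, abs_of_pos h2, abs_of_pos h0]
    gcongr

theorem abs_curlKer_zero_le (j k : Fin 3) (x : E3) : |curlKer 0 j k x| ≤ 6 / ‖x‖ ^ 3 := by
  rcases eq_or_ne x 0 with rfl | hx
  · simp [curlKer]
  · have h0 : 0 < ‖x‖ := norm_pos_iff.2 hx
    have hc (i : Fin 3) : |x i| ≤ ‖x‖ := PiLp.norm_apply_le x i
    have h1 : |∑ i, x i| ≤ 3 * ‖x‖ := by
      rw [Fin.sum_univ_three]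
      refine (abs_add_three _ _ _).trans ?_
      linarith [hc 0, hc 1, hc 2]
    have h2 : |x j - x k| ≤ 2 * ‖x‖ := (abs_sub _ _).trans (by linarith [hc j, hc k])
    rw [curlKer, inner_sigma, regNorm_zero, abs_div, abs_mul, abs_pow, abs_of_pos h0]
    calc _ ≤ (3 * ‖x‖) * (2 * ‖x‖) / ‖x‖ ^ 5 := by gcongr
      _ = _ := by field_simp; norm_num

theorem measurable_curlKer (ε : ℝ) (j k : Fin 3) : Measurable (curlKer ε j k) := by
  unfold curlKer
  have := continuous_regNorm (ε := ε)
  exact Measurable.div (Continuous.measurable (by fun_prop)) (this.pow 5).measurable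

theorem integrableOn_ball_norm_rpow {α : ℝ} (hα : 0 < α) :
    IntegrableOn (fun x : E3 ↦ ‖x‖ ^ (α - 3)) (Metric.ball 0 1) := by
  rw [integrableOn_fun_norm_addHaar (volume : Measure E3) (f := fun y ↦ y ^ (α - 3))]
  have h : IntegrableOn (fun y : ℝ ↦ y ^ (α - 1)) (Set.Ioo 0 1) :=
    (intervalIntegral.integrableOn_Ioo_rpow_iff one_pos).2 (by linarith)
  refine h.congr_fun (fun y hy ↦ ?_) measurableSet_Ioo
  have hy0 : 0 < y := hy.1
  simp only [finrank_euclideanSpace, Fintype.card_fin, smul_eq_mul]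
  rw [← Real.rpow_natCast, ← Real.rpow_add hy0]
  congr 1
  push_cast
  ring

/-- Near 0 the product is `O(|x|^{α-3})`, which is integrable in dimension 3; away from 0 both
factors are square integrable. -/
theorem integrable_curlKer_mul {w : E3 → ℝ} (hw : MemLp w 2) {α C : ℝ} (hα : 0 < α)
    (hC : ∀ x, |w x| ≤ C * ‖x‖ ^ α) (j k : Fin 3) :
    Integrable fun x ↦ curlKer 0 j k x * w x := by
  have hm : AEStronglyMeasurable (fun x ↦ curlKer 0 j k x * w x) volume :=
    (measurable_curlKer 0 j k).aestronglyMeasurable.mul hw.1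
  rw [← integrableOn_univ, ← Set.union_compl_self (Metric.ball (0 : E3) 1)]
  refine IntegrableOn.union ?_ ?_
  · refine ((integrableOn_ball_norm_rpow hα).const_mul (6 * C)).mono' hm.restrict
      (.of_forall fun x ↦ ?_)
    rw [norm_mul, Real.norm_eq_abs, Real.norm_eq_abs]
    rcases eq_or_ne x 0 with rfl | hx
    · have h1 := hC 0
      rw [norm_zero, Real.zero_rpow hα.ne', mul_zero] at h1
      have : |w 0| = 0 := le_antisymm h1 (abs_nonneg _)
      have h2 : |curlKer 0 j k 0| = 0 := by simp [curlKer]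
      rw [h2, zero_mul, norm_zero]
      -- At `x = 0` the majorant is `6 C * 0 ^ (α - 3)`. This vanishes unless `α = 3`, where `0 ^ 0
      -- = 1` and `C ≥ 0` is needed; it follows from `hC` at a unit vector.
      rcases eq_or_ne α 3 with rfl | h3
      · have := (abs_nonneg _).trans (hC (e 0))
        simp [e] at this
        simpa using this
      · rw [Real.zero_rpow (sub_ne_zero.2 h3), mul_zero]
    · have h0 : 0 < ‖x‖ := norm_pos_iff.2 hx
      calc |curlKer 0 j k x| * |w x| ≤ 6 / ‖x‖ ^ 3 * (C * ‖x‖ ^ α) := by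
            gcongr
            · exact abs_curlKer_zero_le j k x
            · exact hC x
        _ = 6 * C * ‖x‖ ^ (α - 3) := by
            rw [Real.rpow_sub h0, show (3 : ℝ) = ((3 : ℕ) : ℝ) by norm_num, Real.rpow_natCast]
            ring
  -- For `|x| ≥ 1`, `regNorm 1 x ≤ 2|x|`, whence `48 = 6 * 2³`.
  · have h := ((memLp_two_one_div_regNorm_pow one_pos (n := 3) (by norm_num)).integrable_mul
      hw.norm).const_mul 48
    refine h.integrableOn.mono' hm.restrict ?_
    filter_upwards [ae_restrict_mem Metric.isOpen_ball.measurableSet.compl] with x hx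
    have hx1 : 1 ≤ ‖x‖ := by simpa using hx
    have h1 : regNorm 1 x ≤ 2 * ‖x‖ := by
      apply Real.sqrt_le_iff.2 ⟨by positivity, by nlinarith⟩
    have h2 := regNorm_pos one_pos x
    rw [norm_mul, Real.norm_eq_abs, Pi.mul_apply, ← mul_assoc]
    gcongr
    calc |curlKer 0 j k x| ≤ 6 / ‖x‖ ^ 3 := abs_curlKer_zero_le j k x
      _ = 48 * (1 / (2 * ‖x‖) ^ 3) := by field_simp; norm_num
      _ ≤ 48 * (1 / regNorm 1 x ^ 3) := by gcongr

/-- Dominated convergence: regularizing only enlarges the denominator, so the limiting integrand is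
itself a majorant. -/
theorem tendsto_integral_curlKer {w : E3 → ℝ} (hm : AEStronglyMeasurable w volume) {j k : Fin 3}
    (hi : Integrable fun x ↦ curlKer 0 j k x * w x) :
    Tendsto (fun ε ↦ ∫ x, curlKer ε j k x * w x) (𝓝[>] 0) (𝓝 (∫ x, curlKer 0 j k x * w x)) := by
  refine tendsto_integral_filter_of_dominated_convergence _ ?_ ?_ hi.norm ?_
  · exact .of_forall fun ε ↦ (measurable_curlKer ε j k).aestronglyMeasurable.mul hm
  · refine .of_forall fun ε ↦ .of_forall fun x ↦ ?_
    rw [norm_mul, norm_mul]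
    gcongr
    exact abs_curlKer_le_abs_curlKer_zero ε j k x
  · refine .of_forall fun x ↦ Tendsto.mul_const _ ?_
    rcases eq_or_ne x 0 with rfl | hx
    · simp [curlKer]
    · have h0 : regNorm 0 x ≠ 0 := by simpa [regNorm_zero] using hx
      have hc : Continuous fun ε ↦ regNorm ε x := by unfold regNorm; fun_prop
      exact ((tendsto_const_nhds.div ((hc.tendsto 0).pow 5) (pow_ne_zero _ h0))).mono_left
        nhdsWithin_le_nhds

end Singular

/-! ### The integral identity for divergence free fields -/

section Identity

variable {V : Fin 3 → E3 → ℝ}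

theorem divergence_eq_zero {u : E3 → E3} (hu : WeaklyDivFree u) (hVu : ∀ i, V i =ᵐ[volume] (u · i))
    (hV : ∀ i, ContDiff ℝ 1 (V i)) (x : E3) : ∑ i, fderiv ℝ (V i) x (e i) = 0 := by
  have hc (i k : Fin 3) : Continuous fun x ↦ fderiv ℝ (V i) x (e k) :=
    ((hV i).continuous_fderiv one_ne_zero).clm_apply continuous_const
  have hcs : Continuous fun x ↦ ∑ i, fderiv ℝ (V i) x (e i) :=
    continuous_finsetSum _ fun i _ ↦ hc i i
  have : (fun x ↦ ∑ i, fderiv ℝ (V i) x (e i)) =ᵐ[volume] fun _ ↦ 0 := by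
    refine ae_eq_zero_of_integral_contDiff_smul_eq_zero hcs.locallyIntegrable fun φ hφ hφc ↦ ?_
    have hφd : ∀ i, Continuous fun x ↦ fderiv ℝ φ x (e i) := fun i ↦
      (hφ.continuous_fderiv (by simp)).clm_apply continuous_const
    have hφs (i : Fin 3) : HasCompactSupport fun x ↦ fderiv ℝ φ x (e i) :=
      hφc.fderiv_apply (𝕜 := ℝ) (e i)
    have i1 (i : Fin 3) : Integrable fun x ↦ V i x * fderiv ℝ φ x (e i) :=
      ((hV i).continuous.mul (hφd i)).integrable_of_hasCompactSupport (hφs i).mul_left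
    have i2 (i : Fin 3) : Integrable fun x ↦ fderiv ℝ (V i) x (e i) * φ x :=
      ((hc i i).mul hφ.continuous).integrable_of_hasCompactSupport hφc.mul_left
    have i3 (i : Fin 3) : Integrable fun x ↦ V i x * φ x :=
      ((hV i).continuous.mul hφ.continuous).integrable_of_hasCompactSupport hφc.mul_left
    have h1 := hu φ hφ hφc
    have h2 : ∫ x, ∑ i, u x i * fderiv ℝ φ x (e i) = ∫ x, ∑ i, V i x * fderiv ℝ φ x (e i) := by
      apply integral_congr_ae
      filter_upwards [ae_all_iff.2 hVu] with x hx
      simp only [hx]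
    have h3 (i : Fin 3) : ∫ x, V i x * fderiv ℝ φ x (e i) =
        -∫ x, fderiv ℝ (V i) x (e i) * φ x :=
      integral_mul_fderiv_eq_neg_fderiv_mul_of_integrable (i2 i) (i1 i) (i3 i)
        (fun x _ ↦ (hV i).differentiable one_ne_zero x)
        (fun x _ ↦ hφ.differentiable (by simp) x)
    rw [h2, integral_finsetSum _ fun i _ ↦ i1 i] at h1
    simp_rw [h3, Finset.sum_neg_distrib] at h1
    rw [← integral_finsetSum _ fun i _ ↦ i2 i, neg_eq_zero] at h1
    rw [← h1]
    congr 1 with x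
    rw [smul_eq_mul, Finset.mul_sum]
    exact Finset.sum_congr rfl fun i _ ↦ mul_comm _ _
  exact congrFun ((hcs.ae_eq_iff_eq volume continuous_const).1 this) x

/-- Write `A i j k l = ∫ K_ij ∂_k V_l`, which is symmetric in its first three indices. For each `i`,
the curl terms become the sum over `j ≠ k` of `A i j j k - A i j k k`. Zero divergence turns the
subtracted terms into the missing `A i j j j`, and the resulting full sum of `A i j j l` is a trace
of the Hessian. -/
theorem sum_integral_curlKer {ε : ℝ} (hε : 0 < ε) (hV : ∀ l, Differentiable ℝ (V l))
    (hV2 : ∀ l, MemLp (V l) 2) (hd : ∀ l v, MemLp (fun x ↦ fderiv ℝ (V l) x v) 2)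
    (hdiv : ∀ x, ∑ i, fderiv ℝ (V i) x (e i) = 0) :
    3 * ((∫ x, curlKer ε 1 2 x * (fderiv ℝ (V 2) x (e 1) - fderiv ℝ (V 1) x (e 2))) +
      (∫ x, curlKer ε 2 0 x * (fderiv ℝ (V 0) x (e 2) - fderiv ℝ (V 2) x (e 0))) +
      ∫ x, curlKer ε 0 1 x * (fderiv ℝ (V 1) x (e 0) - fderiv ℝ (V 0) x (e 1))) =
    -∑ i, ∑ l, ∫ x, 3 * ε ^ 2 / regNorm ε x ^ 5 * fderiv ℝ (V l) x (e i) := by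
  set A : Fin 3 → Fin 3 → Fin 3 → Fin 3 → ℝ := fun i j k l ↦
    ∫ x, kerHess ε i j x * fderiv ℝ (V l) x (e k) with hA
  have hi (i j k l : Fin 3) : Integrable fun x ↦ kerHess ε i j x * fderiv ℝ (V l) x (e k) :=
    (memLp_two_kerHess hε i j).integrable_mul (hd l (e k))
  have hK (j k : Fin 3) :
      3 * ∫ x, curlKer ε j k x * (fderiv ℝ (V k) x (e j) - fderiv ℝ (V j) x (e k)) =
        ∑ i, (A i j j k - A i j k j - (A i k j k - A i k k j)) := by
    simp_rw [hA, ← integral_sub (hi _ _ _ _) (hi _ _ _ _)]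
    simp_rw [← integral_sub ((hi _ _ _ _).sub' (hi _ _ _ _)) ((hi _ _ _ _).sub' (hi _ _ _ _))]
    rw [← integral_finsetSum _ fun i _ ↦
      ((hi _ _ _ _).sub' (hi _ _ _ _)).sub' ((hi _ _ _ _).sub' (hi _ _ _ _)),
      ← integral_const_mul]
    congr 1 with x
    rw [← mul_assoc, three_mul_curlKer, Finset.sum_mul]
    exact Finset.sum_congr rfl fun i _ ↦ by ring
  have hsymm (i j k l : Fin 3) : A i j k l = A j i k l := by
    simp only [hA, kerHess, kron_comm i j, mul_right_comm]
  have hswap (i j k l : Fin 3) : A i j k l = A i k j l :=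
    integral_kerHess_mul_fderiv_swap hε (hV l) (hV2 l) (fun k ↦ hd l (e k)) i j k
  have hdivA (i j : Fin 3) : ∑ l, A i j l l = 0 := by
    simp_rw [hA]
    rw [← integral_finsetSum _ fun l _ ↦ hi i j l l]
    simp_rw [← Finset.mul_sum, hdiv, mul_zero, integral_zero]
  have htr (i l : Fin 3) : ∑ j, A i j j l =
      -∫ x, 3 * ε ^ 2 / regNorm ε x ^ 5 * fderiv ℝ (V l) x (e i) := by
    have : ∑ j, A i j j l = ∑ j, A j j i l :=
      Finset.sum_congr rfl fun j _ ↦ by rw [hsymm, hswap]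
    rw [this, ← integral_finsetSum _ fun j _ ↦ hi j j i l, ← integral_neg]
    congr 1 with x
    rw [← Finset.sum_mul, sum_kerHess_diag hε, neg_mul]
  rw [mul_add, mul_add, hK, hK, hK]
  simp_rw [← Finset.sum_neg_distrib, ← htr]
  rw [← Finset.sum_add_distrib, ← Finset.sum_add_distrib]
  refine Finset.sum_congr rfl fun i _ ↦ ?_
  have d0 := hdivA i 0
  have d1 := hdivA i 1
  have d2 := hdivA i 2
  simp only [Fin.sum_univ_three] at d0 d1 d2 ⊢
  linarith [hswap i 1 2 1, hswap i 2 1 2, hswap i 2 0 2, hswap i 0 2 0, hswap i 0 1 0,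
    hswap i 1 0 1]

end Identity

/-! ### Consequences of permutation symmetry -/

section Symmetry

/-- The coordinate permutation `(R_p x)_{p i} = x_i`. -/
def permIso (p : Equiv.Perm (Fin 3)) : E3 ≃ₗᵢ[ℝ] E3 :=
  LinearIsometryEquiv.piLpCongrLeft 2 ℝ ℝ p

theorem permIso_apply (p : Equiv.Perm (Fin 3)) (x : E3) (i : Fin 3) : permIso p x (p i) = x i := by
  simp [permIso, LinearIsometryEquiv.piLpCongrLeft_apply]

theorem permIso_e (p : Equiv.Perm (Fin 3)) (i : Fin 3) : permIso p (e i) = e (p i) := by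
  simp [permIso, e]

theorem transform_permMatrix_apply (p : Equiv.Perm (Fin 3)) (u : E3 → E3) (x : E3) (i : Fin 3) :
    transform (p.permMatrix ℝ) u x i = u (permIso p x) (p i) := by
  have h1 : Matrix.toEuclideanLin (p.permMatrix ℝ).transpose x = permIso p x := by
    ext j
    obtain ⟨j, rfl⟩ := p.surjective j
    rw [permIso_apply]
    simp [Matrix.toLpLin_apply, Matrix.transpose_permMatrix, Matrix.permMatrix_mulVec]
  rw [transform, h1]
  simp [Matrix.toLpLin_apply, Matrix.permMatrix_mulVec]

variable {U : E3 → E3}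

theorem apply_permIso (hU : Continuous U) (hsym : PermutationSymmetric U) (p : Equiv.Perm (Fin 3))
    (x : E3) (i : Fin 3) : U (permIso p x) (p i) = U x i := by
  have h1 : (fun x ↦ U (permIso p x) (p i)) =ᵐ[volume] fun x ↦ U x i := by
    filter_upwards [hsym p] with x hx
    rw [← hx, transform_permMatrix_apply]
  have hc1 : Continuous fun x ↦ U (permIso p x) (p i) := by
    have := (permIso p).continuous
    fun_prop
  exact congrFun ((hc1.ae_eq_iff_eq volume (by fun_prop)).1 h1) x

theorem grad_apply (hU : Differentiable ℝ U) (x : E3) (i j : Fin 3) :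
    grad U x i j = fderiv ℝ (fun y ↦ U y j) x (e i) := by
  have := ((EuclideanSpace.proj (𝕜 := ℝ) j).hasFDerivAt.comp x (hU x).hasFDerivAt).fderiv
  have h2 : (⇑(EuclideanSpace.proj (𝕜 := ℝ) j : E3 →L[ℝ] ℝ) ∘ U) = fun y ↦ U y j := rfl
  rw [h2] at this
  rw [this]
  rfl

/-- By continuity the symmetry holds at every point; the chain rule then differentiates it along a
basis vector. -/
theorem grad_permIso (hU : ContDiff ℝ 1 U) (hsym : PermutationSymmetric U)
    (p : Equiv.Perm (Fin 3)) (x : E3) (i j : Fin 3) :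
    grad U (permIso p x) (p i) (p j) = grad U x i j := by
  have hd := hU.differentiable one_ne_zero
  rw [grad_apply hd, grad_apply hd, ← permIso_e]
  have hj : (fun y ↦ U y j) = (fun y ↦ U y (p j)) ∘ permIso p := by
    ext y; exact (apply_permIso hU.continuous hsym p y j).symm
  have hdj : DifferentiableAt ℝ (fun y ↦ U y (p j)) (permIso p x) :=
    ((EuclideanSpace.proj (𝕜 := ℝ) (p j)).differentiable.comp hd) _
  have := (hdj.hasFDerivAt.comp x (permIso p).toContinuousLinearEquiv.hasFDerivAt).fderiv
  rw [hj]
  exact (congrArg (fun T : E3 →L[ℝ] ℝ ↦ T (e i)) this).symm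

/-- The cyclic permutation of the coordinates. -/
abbrev rot : Equiv.Perm (Fin 3) := finRotate 3

theorem lambdaIntegrand_zero (x : E3) : lambdaIntegrand U 0 1 2 x =
    curlKer 0 1 2 x * (grad U x 1 2 - grad U x 2 1) := by
  simp [lambdaIntegrand, curlKer, curl, regNorm_zero]

theorem lambdaIntegrand_one (x : E3) : lambdaIntegrand U 1 2 0 x =
    curlKer 0 2 0 x * (grad U x 2 0 - grad U x 0 2) := by
  simp [lambdaIntegrand, curlKer, curl, regNorm_zero]

theorem lambdaIntegrand_two (x : E3) : lambdaIntegrand U 2 0 1 x =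
    curlKer 0 0 1 x * (grad U x 0 1 - grad U x 1 0) := by
  simp [lambdaIntegrand, curlKer, curl, regNorm_zero]

theorem curlKer_permIso (p : Equiv.Perm (Fin 3)) (x : E3) (j k : Fin 3) :
    curlKer 0 (p j) (p k) (permIso p x) = curlKer 0 j k x := by
  have : ∑ i, permIso p x i = ∑ i, x i := by
    rw [← Equiv.sum_comp p]
    simp_rw [permIso_apply]
  simp [curlKer, inner_sigma, this, permIso_apply, regNorm_zero]

/-- Cyclic coordinate shifts preserve volume and carry one integrand to another, since `σ` and the
norm are invariant. -/
theorem integral_lambdaIntegrand_eq (hU : ContDiff ℝ 1 U) (hsym : PermutationSymmetric U) :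
    ∫ x, lambdaIntegrand U 1 2 0 x = ∫ x, lambdaIntegrand U 0 1 2 x ∧
    ∫ x, lambdaIntegrand U 2 0 1 x = ∫ x, lambdaIntegrand U 0 1 2 x := by
  have key (p : Equiv.Perm (Fin 3)) (j k : Fin 3) :
      ∫ x, curlKer 0 (p j) (p k) x * (grad U x (p j) (p k) - grad U x (p k) (p j)) =
        ∫ x, curlKer 0 j k x * (grad U x j k - grad U x k j) := by
    rw [← (permIso p).measurePreserving.integral_comp
      (permIso p).toHomeomorph.measurableEmbedding]
    simp_rw [curlKer_permIso, grad_permIso hU hsym]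
  simp_rw [lambdaIntegrand_zero, lambdaIntegrand_one, lambdaIntegrand_two]
  exact ⟨key rot 1 2, key (rot.trans rot) 1 2⟩

/-- The gradient of a permutation symmetric, divergence free field at the origin. -/
theorem grad_zero_eq (hU : ContDiff ℝ 1 U) (hsym : PermutationSymmetric U)
    (hdiv : ∑ i, grad U 0 i i = 0) :
    grad U 0 = (-grad U 0 0 1) • !![0, -1, -1; -1, 0, -1; -1, -1, 0] := by
  have h (p : Equiv.Perm (Fin 3)) (i j : Fin 3) : grad U 0 (p i) (p j) = grad U 0 i j := by
    simpa using grad_permIso hU hsym p 0 i j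
  have d1 : grad U 0 1 1 = grad U 0 0 0 := h rot 0 0
  have d2 : grad U 0 2 2 = grad U 0 0 0 := h (rot.trans rot) 0 0
  have o1 : grad U 0 1 2 = grad U 0 0 1 := h rot 0 1
  have o2 : grad U 0 2 0 = grad U 0 0 1 := h (rot.trans rot) 0 1
  -- Cyclic shifts split the six off-diagonal entries into two orbits; a transposition joins them.
  have o3 : grad U 0 1 0 = grad U 0 0 1 := h (Equiv.swap 0 1) 0 1
  have o4 : grad U 0 2 1 = grad U 0 0 1 := (h rot 1 0).trans o3
  have o5 : grad U 0 0 2 = grad U 0 0 1 := (h (rot.trans rot) 1 0).trans o3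
  rw [Fin.sum_univ_three, d1, d2] at hdiv
  have d0 : grad U 0 0 0 = 0 := by linarith
  ext i j
  fin_cases i <;> fin_cases j <;> simp [d0, d1, d2, o1, o2, o3, o4, o5]

end Symmetry

/-! ### Passage to the limit and conclusion -/

/-- The value of the gradient at the origin from the vorticity, for a `C^{1, α}` field with
square integrable gradient. -/
theorem eq_integral_lambdaIntegrand {U : E3 → E3} {α C C' : ℝ} (hα : 0 < α) (hU : ContDiff ℝ 1 U)
    (hsym : PermutationSymmetric U) (hU2 : ∀ l, MemLp (fun x ↦ U x l) 2)
    (hd : ∀ l v, MemLp (fun x ↦ fderiv ℝ (fun y ↦ U y l) x v) 2)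
    (hb : ∀ x i j, |grad U x i j| ≤ C) (hh : ∀ x i j, |grad U x i j - grad U 0 i j| ≤ C' * ‖x‖ ^ α)
    (hdiv : ∀ x, ∑ i, grad U x i i = 0) :
    Integrable (lambdaIntegrand U 0 1 2) ∧ Integrable (lambdaIntegrand U 1 2 0) ∧
      Integrable (lambdaIntegrand U 2 0 1) ∧
      -grad U 0 0 1 = 3 / (8 * π) * ∫ x, lambdaIntegrand U 0 1 2 x := by
  have hUd := hU.differentiable one_ne_zero
  have hgc (i j : Fin 3) : Continuous fun x ↦ grad U x i j := by
    have h1 := (hU.continuous_fderiv one_ne_zero).clm_apply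
      (continuous_const : Continuous fun _ : E3 ↦ e i)
    exact (EuclideanSpace.proj (𝕜 := ℝ) j).continuous.comp h1
  have hg2 (i j : Fin 3) : MemLp (fun x ↦ grad U x i j) 2 := by
    simp_rw [grad_apply hUd]
    exact hd j (e i)
  have h0 := grad_zero_eq hU hsym (hdiv 0)
  set lam := -grad U 0 0 1 with hlam
  -- Symmetry of the gradient at 0 makes the vorticity vanish there, so the Hölder bound gives the
  -- decay that integrability requires.
  have h0s (i j : Fin 3) : grad U 0 i j = grad U 0 j i := by
    rw [h0]
    fin_cases i <;> fin_cases j <;> simp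
  have hint (j k : Fin 3) :
      Integrable fun x ↦ curlKer 0 j k x * (grad U x j k - grad U x k j) := by
    refine integrable_curlKer_mul ((hg2 j k).sub (hg2 k j)) (C := 2 * C') hα (fun x ↦ ?_) j k
    calc |grad U x j k - grad U x k j|
        = |(grad U x j k - grad U 0 j k) - (grad U x k j - grad U 0 k j)| := by
          rw [h0s j k]; congr 1; ring
      _ ≤ C' * ‖x‖ ^ α + C' * ‖x‖ ^ α := (abs_sub _ _).trans (add_le_add (hh x j k) (hh x k j))
      _ = 2 * C' * ‖x‖ ^ α := by ring
  have e0 : lambdaIntegrand U 0 1 2 = _ := funext lambdaIntegrand_zero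
  have e1 : lambdaIntegrand U 1 2 0 = _ := funext lambdaIntegrand_one
  have e2 : lambdaIntegrand U 2 0 1 = _ := funext lambdaIntegrand_two
  refine ⟨e0 ▸ hint 1 2, e1 ▸ hint 2 0, e2 ▸ hint 0 1, ?_⟩
  obtain ⟨s1, s2⟩ := integral_lambdaIntegrand_eq hU hsym
  set I := ∫ x, lambdaIntegrand U 0 1 2 x with hI
  have lim (j k : Fin 3) := tendsto_integral_curlKer ((hg2 j k).sub (hg2 k j)).1 (hint j k)
  have limL := (((lim 1 2).add (lim 2 0)).add (lim 0 1)).const_mul 3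
  have limR : Tendsto (fun ε : ℝ ↦ -∑ i, ∑ l, ∫ x, 3 * ε ^ 2 / regNorm ε x ^ 5 * grad U x i l)
      (𝓝[>] 0) (𝓝 (-∑ i, ∑ l, 4 * π * grad U 0 i l)) :=
    (tendsto_finsetSum _ fun i _ ↦ tendsto_finsetSum _ fun l _ ↦
      tendsto_integral_regNorm_mul (hgc i l) fun x ↦ hb x i l).neg
  have heq := tendsto_nhds_unique (limL.congr' ?_) limR
  · simp only [Pi.sub_apply] at heq
    have j0 : ∫ x, curlKer 0 1 2 x * (grad U x 1 2 - grad U x 2 1) = I := by rw [hI, e0]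
    have j1 : ∫ x, curlKer 0 2 0 x * (grad U x 2 0 - grad U x 0 2) = I := by rw [← s1, e1]
    have j2 : ∫ x, curlKer 0 0 1 x * (grad U x 0 1 - grad U x 1 0) = I := by rw [← s2, e2]
    -- Six off-diagonal entries, each equal to `-lam`.
    have hsum : ∑ i, ∑ l, 4 * π * grad U 0 i l = -(24 * π * lam) := by
      rw [h0]
      simp [Fin.sum_univ_three]
      ring
    rw [j0, j1, j2, hsum] at heq
    have := Real.pi_pos
    field_simp
    linarith
  · filter_upwards [self_mem_nhdsWithin] with ε hε
    have := sum_integral_curlKer (V := fun l x ↦ U x l) hε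
      (fun l ↦ (EuclideanSpace.proj (𝕜 := ℝ) l).differentiable.comp hUd) hU2 hd
      (fun x ↦ by simpa only [grad_apply hUd] using hdiv x)
    simp only [← grad_apply hUd] at this
    exact this

end PermSymm

end

theorem mainTheorem5 (s : ℝ) (hs : 5 / 2 < s) (u : PermSymm.E3 → PermSymm.E3)
    (hu : PermSymm.MemHsDf s u) (hsym : PermSymm.PermutationSymmetric u) :
    ∃ U : PermSymm.E3 → PermSymm.E3,
      U =ᵐ[MeasureTheory.volume] u ∧ ContDiff ℝ 1 U ∧
      ∃ lam : ℝ,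
        PermSymm.grad U 0 = lam • !![0, -1, -1; -1, 0, -1; -1, -1, 0] ∧
        (MeasureTheory.Integrable (PermSymm.lambdaIntegrand U 0 1 2) MeasureTheory.volume ∧
          lam = 3 / (8 * Real.pi) * ∫ x : PermSymm.E3, PermSymm.lambdaIntegrand U 0 1 2 x) ∧
        (MeasureTheory.Integrable (PermSymm.lambdaIntegrand U 1 2 0) MeasureTheory.volume ∧
          lam = 3 / (8 * Real.pi) * ∫ x : PermSymm.E3, PermSymm.lambdaIntegrand U 1 2 0 x) ∧
        (MeasureTheory.Integrable (PermSymm.lambdaIntegrand U 2 0 1) MeasureTheory.volume ∧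
          lam = 3 / (8 * Real.pi) * ∫ x : PermSymm.E3, PermSymm.lambdaIntegrand U 2 0 1 x) := by
  obtain ⟨α, hα0, hα1, hα⟩ : ∃ α : ℝ, 0 < α ∧ α ≤ 1 ∧ 5 / 2 + α < s := by
    -- Half of the excess regularity keeps the inequality strict; the cap at 1 is needed for a
    -- Hölder exponent.
    refine ⟨min 1 ((s - 5 / 2) / 2), lt_min one_pos (by linarith), min_le_left _ _, ?_⟩
    linarith [min_le_right 1 ((s - 5 / 2) / 2)]
  have hrep (i : Fin 3) := PermSymm.exists_contDiff_one_of_memSobolev_real hα0 hα1 hα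
    (hu.1 i).choose_spec.1 (hu.1 i).choose_spec.2
  choose V hVu hV hV2 hd hb C' hC' using hrep
  choose C hC using hb
  set U : PermSymm.E3 → PermSymm.E3 := fun x ↦ WithLp.toLp 2 fun i ↦ V i x with hUdef
  have hUu : U =ᵐ[MeasureTheory.volume] u := by
    filter_upwards [MeasureTheory.ae_all_iff.2 hVu] with x hx
    ext i
    exact hx i
  have hU : ContDiff ℝ 1 U := contDiff_euclidean.2 hV
  have hUd := hU.differentiable one_ne_zero
  have hg (x : PermSymm.E3) (i j : Fin 3) :
      PermSymm.grad U x i j = fderiv ℝ (V j) x (PermSymm.e i) := PermSymm.grad_apply hUd x i j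
  have hsymU : PermSymm.PermutationSymmetric U := by
    -- The symmetry of `u` passes to `U` because the isometry pulls null sets back to null sets.
    intro p
    have hq := (PermSymm.permIso p).measurePreserving.quasiMeasurePreserving.ae hUu
    filter_upwards [hsym p, hUu, hq] with x h1 h2 h3
    rw [h2, ← h1]
    ext i
    rw [PermSymm.transform_permMatrix_apply, PermSymm.transform_permMatrix_apply, h3]
  have hdiv (x : PermSymm.E3) : ∑ i, PermSymm.grad U x i i = 0 := by
    simp_rw [hg]
    exact PermSymm.divergence_eq_zero hu.2 hVu hV x
  have hle (T : PermSymm.E3 →L[ℝ] ℝ) (i : Fin 3) : |T (PermSymm.e i)| ≤ ‖T‖ := by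
    simpa [PermSymm.e] using T.le_opNorm (PermSymm.e i)
  obtain ⟨B, hB⟩ : ∃ B, ∀ i, C i ≤ B := (Set.finite_range C).bddAbove.imp fun B h i ↦ h ⟨i, rfl⟩
  obtain ⟨B', hB'⟩ : ∃ B', ∀ i, C' i ≤ B' :=
    (Set.finite_range C').bddAbove.imp fun B h i ↦ h ⟨i, rfl⟩
  obtain ⟨i0, i1, i2, hlam⟩ := PermSymm.eq_integral_lambdaIntegrand (C := B) (C' := B') hα0 hU
    hsymU hV2 hd
    (fun x i j ↦ by rw [hg]; exact (hle _ i).trans ((hC j x).trans (hB j)))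
    (fun x i j ↦ by
      rw [hg, hg, ← sub_apply]
      refine (hle _ i).trans ((hC' j x 0).trans ?_)
      rw [sub_zero]
      gcongr
      exact hB' j) hdiv
  obtain ⟨s1, s2⟩ := PermSymm.integral_lambdaIntegrand_eq hU hsymU
  exact ⟨U, hUu, hU, -PermSymm.grad U 0 0 1, PermSymm.grad_zero_eq hU hsymU (hdiv 0),
    ⟨i0, hlam⟩, ⟨i1, by rw [s1, hlam]⟩, ⟨i2, by rw [s2, hlam]⟩⟩
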